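/- For integers $a_1,\dots,a_d\ge 1$ with $a_1\ge2$ and $|z|\le 1$ let $$\operatorname{Li}_{a_1,\ldots,a_d}(z)=\sum_{n_1>\cdots>n_d>0}\frac{z^{n_1}}{n_1^{a_1}\cdots n_d^{a_d}},\qquad \zeta(a_1,\ldots,a_d)=\operatorname{Li}_{a_1,\ldots,a_d}(1),$$ write $\{1\}^b$ for the string $1,\dots,1$ of length $b$, and for integers $n\ge1$ and $0\le k\le n-1$ let $$\operatorname{Ls}_n^{(k)}(\tau)=-\int_0^\tau \theta^k\,\log^{n-1-k}\left|2\sin\tfrac\theta2\right|\,d\theta .$$ With $w=a_1+\cdots+a_d$, let $\operatorname{Cl}_{a_1,\ldots,a_d}(\tau)$ be the imaginary part of $\operatorname{Li}_{a_1,\ldots,a_d}(e^{i\tau})$ if $w$ is even and its real part if $w$ is odd, and let $\operatorname{Gl}_{a_1,\ldots,a_d}(\tau)$ be the other of the two parts. Let $\binom{N}{a,b,c}=\frac{N!}{a!\,b!\,c!\,(N-a-b-c)!}$. The series $\operatorname{Li}_{s,\{1\}^b}(z)$ with $s\ge2$, $b\ge 0$, $|z|\le1$ and the integrals $\operatorname{Ls}_n^{(k)}(\tau)$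 with $0\le k\le n-1$, $0\le\tau\le2\pi$ converge absolutely, and the following hold. (a) For $0\le\tau\le2\pi$ and nonnegative integers $n,k$ with $n-k\ge2$, $$\zeta(n-k,\{1\}^k)-\sum_{j=0}^{k}\frac{(-i\tau)^j}{j!}\operatorname{Li}_{2+k-j,\{1\}^{n-k-2}}(e^{i\tau}) =\frac{i^{k+1}(-1)^{n-1}}{(n-1)!}\sum_{r=0}^{n-k-1}\sum_{m=0}^{r}\binom{n-1}{k,m,r-m}\left(\frac i2\right)^r(-\pi)^{r-m}\operatorname{Ls}_{n-(r-m)}^{(k+m)}(\tau).$$ (b) For all integers $0\le k\le n-1$, the function $\tau\mapsto\operatorname{Ls}_n^{(k)}(\tau)$ on $[0,2\pi]$ is a polynomial with rational coefficients (not depending on $\tau$) in $\pi$, $\tau$, multiple zeta values $\zeta(s,\{1\}^b)$, and the multiple Clausen and Glaisher functions $\operatorname{Cl}_{s,\{1\}^b}(\tau)$, $\operatorname{Gl}_{s,\{1\}^b}(\tau)$ (the real and imaginary parts of the Nielsen polylogarithms $\operatorname{Li}_{s,\{1\}^b}(e^{i\tau})$), with $s\ge2$, $b\ge0$. -/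

import Mathlib

noncomputable section

/-- The index set of a multiple polylogarithm of depth `d + 1`:
tuples of integers `n₁ > n₂ > ⋯ > n_{d+1} > 0`. -/
abbrev DecTuple (d : ℕ) : Type :=
  {n : Fin (d + 1) → ℕ // StrictAnti n ∧ ∀ i, 0 < n i}

/-- The general term `z^{n₁} / (n₁^{a₁} ⋯ n_{d+1}^{a_{d+1}})`. -/
def multiPolylogTerm {d : ℕ} (a : Fin (d + 1) → ℕ) (z : ℂ) (n : DecTuple d) : ℂ :=
  z ^ (n.1 0) / ∏ i, (n.1 i : ℂ) ^ (a i)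

/-- The multiple polylogarithm `Li_{a₁,…,a_{d+1}}(z)`. -/
def multiPolylog {d : ℕ} (a : Fin (d + 1) → ℕ) (z : ℂ) : ℂ :=
  ∑' n : DecTuple d, multiPolylogTerm a z n

/-- The multiple zeta value `ζ(a₁,…,a_{d+1})`. -/
def multiZeta {d : ℕ} (a : Fin (d + 1) → ℕ) : ℂ :=
  multiPolylog a 1

/-- The index string `(s, {1}^b)`. -/
def nielsenIndex (s b : ℕ) : Fin (b + 1) → ℕ :=
  Fin.cons (α := fun _ => ℕ) s (fun _ => 1)

open Classical in
/-- The multiple Clausen function. -/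
def multiClausen {d : ℕ} (a : Fin (d + 1) → ℕ) (θ : ℝ) : ℝ :=
  if Even (∑ i, a i) then (multiPolylog a (Complex.exp (Complex.I * θ))).im
  else (multiPolylog a (Complex.exp (Complex.I * θ))).re

open Classical in
/-- The multiple Glaisher function. -/
def multiGlaisher {d : ℕ} (a : Fin (d + 1) → ℕ) (θ : ℝ) : ℝ :=
  if Even (∑ i, a i) then (multiPolylog a (Complex.exp (Complex.I * θ))).re
  else (multiPolylog a (Complex.exp (Complex.I * θ))).im

/-- The integrand `θ^k log^{n-1-k} |2 sin(θ/2)|`; it is used only for `k + 1 ≤ n`, where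
the subtraction of natural numbers is exact. -/
def logSineIntegrand (n k : ℕ) (θ : ℝ) : ℝ :=
  θ ^ k * Real.log |2 * Real.sin (θ / 2)| ^ (n - 1 - k)

/-- The generalized log-sine integral `Ls_n^{(k)}(σ)`, for `k + 1 ≤ n`. -/
def logSine (n k : ℕ) (σ : ℝ) : ℝ :=
  -∫ θ in (0 : ℝ)..σ, logSineIntegrand n k θ

/-- The multinomial coefficient `N! / (a! b! c! (N - a - b - c)!)`, for `a + b + c ≤ N`. -/
def multinom3 (N a b c : ℕ) : ℚ :=
  (N.factorial : ℚ) /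
    (a.factorial * b.factorial * c.factorial * (N - a - b - c).factorial)

/-- The functions on `[0, 2π]` through which log-sine integrals are expressed: the constant `π`,
the identity `τ`, the multiple zeta values `ζ(s,{1}^b)` (as constants), and the multiple Clausen
and Glaisher functions of index `(s,{1}^b)`, with `s ≥ 2`; the last two are the real and imaginary
parts of the Nielsen polylogarithms at `e^{iτ}`. -/
inductive IsLogSineGenerator : (Set.Icc (0 : ℝ) (2 * Real.pi) → ℝ) → Prop
  | pi : IsLogSineGenerator (fun _ => Real.pi)
  | arg : IsLogSineGenerator (fun τ => (τ : ℝ))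
  | zeta (s b : ℕ) (hs : 2 ≤ s) :
      IsLogSineGenerator (fun _ => (multiZeta (nielsenIndex s b)).re)
  | clausen (s b : ℕ) (hs : 2 ≤ s) :
      IsLogSineGenerator (fun τ => multiClausen (nielsenIndex s b) τ)
  | glaisher (s b : ℕ) (hs : 2 ≤ s) :
      IsLogSineGenerator (fun τ => multiGlaisher (nielsenIndex s b) τ)

end

/-!
Let `S(u, z) = ∑_{j ≤ k} u^j / j! · Li_{2+k-j,{1}^b}(z)`. Along a curve on which `u = -log z`, the
differential equations of the polylogarithms make the derivative of `S(u, z)` telescope, leaving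
only `u^k / k! · Li_{1,{1}^b}(z) dz / z`, where `Li_{1,{1}^b}(z) = (-log (1 - z))^{b+1} / (b + 1)!`.

On the arcs `r e^{it}`, `0 ≤ t ≤ τ`, with `u = -it`, this evaluates `S(-iτ, r e^{iτ}) - S(0, r)` as
an integral; letting `r → 1` and expanding `log (1 - e^{it}) = log |2 sin (t/2)| + i (t - π) / 2`
by the multinomial theorem turns the integral into log-sine integrals. The term `S(0, 1)` is
`ζ(2+k,{1}^b)`, which equals `ζ(2+b,{1}^k)`: with `u = -log x` on `(0, 1)`, the sum of `S`, of its
image under `x ↦ 1 - x`, `k ↔ b`, and of a product of powers of logarithms is constant. The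
resulting identity contains `Ls_n^{(k)}` once, and otherwise only log-sine integrals with smaller
`n - k`, so it can be solved for `Ls_n^{(k)}` recursively.
-/

noncomputable section

open Filter Topology MeasureTheory Set
open Complex (I)
open Matrix (vecCons)
open scoped Nat Real

namespace DecTuple

variable {d : ℕ}

lemma le_head (t : DecTuple d) (i : Fin (d + 1)) : t.1 i ≤ t.1 0 :=
  t.2.1.antitone (Fin.zero_le i)

lemma cast_ne_zero (t : DecTuple d) (i : Fin (d + 1)) : (t.1 i : ℂ) ≠ 0 :=
  Nat.cast_ne_zero.2 (t.2.2 i).ne'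

/-- Decreasing tuples with one entry are positive integers, indexed by their predecessors. -/
def natEquiv : ℕ ≃ DecTuple 0 where
  toFun n := ⟨fun _ => n + 1, fun i j h => absurd h (by omega), fun _ => n.succ_pos⟩
  invFun t := t.1 0 - 1
  left_inv _ := rfl
  right_inv t := Subtype.ext <| funext fun i => by
    obtain rfl := Fin.fin_one_eq_zero i
    exact Nat.sub_add_cancel (t.2.2 0)

/-- Decreasing tuples of length `d + 2` correspond to pairs of a decreasing tuple of length `d + 1`
and a gap `k`, the new largest entry being `t₀ + 1 + k`. -/
def consEquiv (d : ℕ) : DecTuple d × ℕ ≃ DecTuple (d + 1) where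
  toFun p := ⟨vecCons (p.1.1 0 + 1 + p.2) p.1.1, strictAnti_vecCons.2 ⟨by omega, p.1.2.1⟩,
    Fin.cases (by simp only [Matrix.cons_val_zero]; omega) p.1.2.2⟩
  invFun t := ⟨⟨fun i => t.1 i.succ, fun _ _ h => t.2.1 (Fin.succ_lt_succ_iff.2 h),
    fun i => t.2.2 i.succ⟩, t.1 0 - t.1 1 - 1⟩
  left_inv p := Prod.ext (Subtype.ext rfl) <| by
    change p.1.1 0 + 1 + p.2 - p.1.1 0 - 1 = p.2
    omega
  right_inv t := Subtype.ext <| funext <| Fin.cases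
    (by
      have : t.1 1 < t.1 0 := t.2.1 Fin.zero_lt_one
      change t.1 1 + 1 + (t.1 0 - t.1 1 - 1) = t.1 0
      omega)
    fun _ => rfl

end DecTuple

section Convergence

lemma summable_fin_prod {β : Type*} {d : ℕ} {f : Fin d → β → ℝ} (hf : ∀ i, Summable (f i))
    (hf₀ : ∀ i x, 0 ≤ f i x) : Summable fun x : Fin d → β => ∏ i, f i (x i) := by
  induction d with
  | zero => exact .of_finite
  | succ d ih =>
    rw [← (Fin.consEquiv fun _ => β).summable_iff]
    refine ((hf 0).mul_of_nonneg (ih (fun i => hf i.succ) fun i => hf₀ i.succ) (hf₀ 0)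
      fun x => Finset.prod_nonneg fun i _ => hf₀ i.succ _).congr fun p => ?_
    simp [Fin.prod_univ_succ, Fin.consEquiv]

lemma summable_decTuple_prod {f : ℕ → ℝ} (hf : Summable f) (hf₀ : ∀ n, 0 ≤ f n) (d : ℕ) :
    Summable fun t : DecTuple d => ∏ i, f (t.1 i) :=
  (summable_fin_prod (fun _ => hf) fun _ => hf₀).comp_injective Subtype.val_injective

variable {d : ℕ} {a : Fin (d + 1) → ℕ} {z : ℂ}

lemma norm_multiPolylogTerm_le_of_norm_le {w : ℂ} (h : ‖z‖ ≤ ‖w‖) (t : DecTuple d) :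
    ‖multiPolylogTerm a z t‖ ≤ ‖multiPolylogTerm a w t‖ := by
  rw [multiPolylogTerm, multiPolylogTerm, norm_div, norm_div, norm_pow, norm_pow]
  gcongr

lemma norm_multiPolylogTerm_le_pow (t : DecTuple d) :
    ‖multiPolylogTerm a z t‖ ≤ ‖z‖ ^ t.1 0 := by
  have hden : 1 ≤ ‖∏ i, (t.1 i : ℂ) ^ a i‖ := by
    simp only [norm_prod, norm_pow, Complex.norm_natCast]
    exact Finset.one_le_prod fun i _ => one_le_pow₀ (Nat.one_le_cast.2 (t.2.2 i))
  rw [multiPolylogTerm, norm_div, norm_pow]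
  exact div_le_self (by positivity) hden

-- The largest entry dominates the average of all entries, so `‖z‖ ^ t₀` is at most the product of
-- the `r ^ tᵢ`, where `r ^ (d + 1) = ‖z‖`.
lemma summable_multiPolylogTerm_of_norm_lt_one (a : Fin (d + 1) → ℕ) (hz : ‖z‖ < 1) :
    Summable (multiPolylogTerm a z) := by
  set r : ℝ := ‖z‖ ^ ((d + 1 : ℕ) : ℝ)⁻¹
  have hr₀ : 0 ≤ r := by positivity
  have hr₁ : r < 1 := Real.rpow_lt_one (norm_nonneg z) hz (by positivity)
  have hrz : r ^ (d + 1) = ‖z‖ := Real.rpow_inv_natCast_pow (norm_nonneg z) d.succ_ne_zero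
  refine .of_norm_bounded (summable_decTuple_prod (summable_geometric_of_lt_one hr₀ hr₁)
    (fun n => pow_nonneg hr₀ n) d) fun t => ?_
  calc ‖multiPolylogTerm a z t‖ ≤ ‖z‖ ^ t.1 0 := norm_multiPolylogTerm_le_pow t
    _ = ∏ _i : Fin (d + 1), r ^ t.1 0 := by
      rw [Finset.prod_const, Finset.card_fin, pow_right_comm, hrz]
    _ ≤ ∏ i, r ^ t.1 i := Finset.prod_le_prod (fun _ _ => by positivity)
      fun i _ => pow_le_pow_of_le_one hr₀ hr₁.le (t.le_head i)

-- Since `t₀` is at least the geometric mean of the entries, `t₀² t₁ ⋯ t_d` is at least the product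
-- of the `tᵢ ^ (1 + 1 / (d + 1))`.
lemma prod_rpow_one_add_inv_le_prod_pow (ha₀ : 2 ≤ a 0) (ha : ∀ i, 1 ≤ a i) (t : DecTuple d) :
    ∏ i, (t.1 i : ℝ) ^ (1 + ((d + 1 : ℕ) : ℝ)⁻¹) ≤ ∏ i, (t.1 i : ℝ) ^ a i := by
  set ε : ℝ := ((d + 1 : ℕ) : ℝ)⁻¹
  have hone (i) : 1 ≤ (t.1 i : ℝ) := Nat.one_le_cast.2 (t.2.2 i)
  have hgeom : ∏ i, (t.1 i : ℝ) ^ ε ≤ t.1 0 := by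
    calc ∏ i, (t.1 i : ℝ) ^ ε ≤ ∏ _i : Fin (d + 1), (t.1 0 : ℝ) ^ ε := by
          gcongr with i
          exact t.le_head i
      _ = t.1 0 := by
          rw [Finset.prod_const, Finset.card_fin,
            Real.rpow_inv_natCast_pow (Nat.cast_nonneg _) d.succ_ne_zero]
  calc ∏ i, (t.1 i : ℝ) ^ (1 + ε) = (∏ i, (t.1 i : ℝ)) * ∏ i, (t.1 i : ℝ) ^ ε := by
        simp only [Real.rpow_one_add' (Nat.cast_nonneg _) (by positivity : 1 + ε ≠ 0),
          Finset.prod_mul_distrib]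
    _ ≤ (∏ i, (t.1 i : ℝ)) * t.1 0 := by gcongr
    _ = (t.1 0 : ℝ) ^ 2 * ∏ i : Fin d, (t.1 i.succ : ℝ) ^ 1 := by
        simp only [Fin.prod_univ_succ, pow_one]
        ring
    _ ≤ (t.1 0 : ℝ) ^ a 0 * ∏ i : Fin d, (t.1 i.succ : ℝ) ^ a i.succ := by
        gcongr
        exacts [hone 0, hone _, ha _]
    _ = ∏ i, (t.1 i : ℝ) ^ a i := by rw [Fin.prod_univ_succ]

lemma summable_multiPolylogTerm (ha₀ : 2 ≤ a 0) (ha : ∀ i, 1 ≤ a i) (hz : ‖z‖ ≤ 1) :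
    Summable (multiPolylogTerm a z) := by
  have hε : 1 < 1 + ((d + 1 : ℕ) : ℝ)⁻¹ := lt_add_of_pos_right 1 (by positivity)
  refine .of_norm_bounded (summable_decTuple_prod (Real.summable_nat_rpow_inv.2 hε)
    (fun n => by positivity) d) fun t => ?_
  calc ‖multiPolylogTerm a z t‖ ≤ ‖multiPolylogTerm a 1 t‖ :=
        norm_multiPolylogTerm_le_of_norm_le (by simpa using hz) t
    _ = (∏ i, (t.1 i : ℝ) ^ a i)⁻¹ := by
        simp [multiPolylogTerm, norm_prod]
    _ ≤ (∏ i, (t.1 i : ℝ) ^ (1 + ((d + 1 : ℕ) : ℝ)⁻¹))⁻¹ := by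
        refine inv_anti₀ (Finset.prod_pos fun i _ => ?_)
          (prod_rpow_one_add_inv_le_prod_pow ha₀ ha t)
        exact Real.rpow_pos_of_pos (Nat.cast_pos.2 (t.2.2 i)) _
    _ = ∏ i, ((t.1 i : ℝ) ^ (1 + ((d + 1 : ℕ) : ℝ)⁻¹))⁻¹ := (Finset.prod_inv_distrib _).symm

lemma one_le_nielsenIndex {s : ℕ} (hs : 1 ≤ s) (b : ℕ) (i : Fin (b + 1)) :
    1 ≤ nielsenIndex s b i :=
  Fin.cases hs (fun _ => le_rfl) i

lemma continuousOn_multiPolylog (ha₀ : 2 ≤ a 0) (ha : ∀ i, 1 ≤ a i) :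
    ContinuousOn (multiPolylog a) (Metric.closedBall 0 1) := by
  refine continuousOn_tsum (fun t => ?_)
    (summable_multiPolylogTerm ha₀ ha (z := 1) (by simp)).norm fun t z hz => ?_
  · simp only [multiPolylogTerm]
    fun_prop
  · exact norm_multiPolylogTerm_le_of_norm_le (by simpa using hz) t

lemma ofReal_re_multiZeta (a : Fin (d + 1) → ℕ) : ((multiZeta a).re : ℂ) = multiZeta a := by
  have h : multiZeta a = ((∑' t : DecTuple d, (∏ i, (t.1 i : ℝ) ^ a i)⁻¹ : ℝ) : ℂ) := by
    simp [multiZeta, multiPolylog, multiPolylogTerm, Complex.ofReal_tsum]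
  rw [h, Complex.ofReal_re]

lemma multiPolylog_zero (a : Fin (d + 1) → ℕ) : multiPolylog a 0 = 0 := by
  have h (t : DecTuple d) : multiPolylogTerm a 0 t = 0 := by
    rw [multiPolylogTerm, zero_pow (t.2.2 0).ne', zero_div]
  simp only [multiPolylog, h, tsum_zero]

end Convergence

section Derivative

variable {d : ℕ} {z : ℂ}

lemma hasSum_deriv_multiPolylogTerm (a : Fin (d + 1) → ℕ) (hz : ‖z‖ < 1) :
    DifferentiableAt ℂ (multiPolylog a) z ∧
      HasSum (fun t : DecTuple d => t.1 0 * z ^ (t.1 0 - 1) / ∏ i, (t.1 i : ℂ) ^ a i)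
        (deriv (multiPolylog a) z) := by
  obtain ⟨r, hzr, hr⟩ := exists_between hz
  have hr₀ : 0 ≤ r := (norm_nonneg z).trans hzr.le
  have hmem : z ∈ Metric.ball (0 : ℂ) r := by simpa using hzr
  have hnorm : ‖(r : ℂ)‖ = r := Complex.norm_of_nonneg hr₀
  have hsum := (summable_multiPolylogTerm_of_norm_lt_one a (z := r) (hnorm.trans_lt hr)).norm
  have hdiff (t : DecTuple d) :
      DifferentiableOn ℂ (fun w => multiPolylogTerm a w t) (Metric.ball 0 r) := by
    simp only [multiPolylogTerm]
    fun_prop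
  have hle (t : DecTuple d) (w : ℂ) (hw : w ∈ Metric.ball (0 : ℂ) r) :
      ‖multiPolylogTerm a w t‖ ≤ ‖multiPolylogTerm a r t‖ :=
    norm_multiPolylogTerm_le_of_norm_le (hnorm.symm ▸ (mem_ball_zero_iff.1 hw).le) t
  refine ⟨(Complex.differentiableOn_tsum_of_summable_norm hsum hdiff Metric.isOpen_ball
    hle).differentiableAt (Metric.isOpen_ball.mem_nhds hmem), ?_⟩
  refine (Complex.hasSum_deriv_of_summable_norm hsum hdiff Metric.isOpen_ball hle hmem).congr_fun
    fun t => ?_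
  simp [multiPolylogTerm]

lemma differentiableAt_multiPolylog (a : Fin (d + 1) → ℕ) (hz : ‖z‖ < 1) :
    DifferentiableAt ℂ (multiPolylog a) z :=
  (hasSum_deriv_multiPolylogTerm a hz).1

lemma hasDerivAt_multiPolylog_succ (s : ℕ) (a : Fin d → ℕ) (hz : ‖z‖ < 1) (hz₀ : z ≠ 0) :
    HasDerivAt (multiPolylog (vecCons (s + 1) a)) (multiPolylog (vecCons s a) z / z) z := by
  obtain ⟨hdiff, hsum⟩ := hasSum_deriv_multiPolylogTerm (vecCons (s + 1) a) hz
  refine hdiff.hasDerivAt.congr_deriv ?_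
  rw [← hsum.tsum_eq, multiPolylog, ← tsum_div_const]
  refine tsum_congr fun t => ?_
  have hpow : z ^ t.1 0 = z ^ (t.1 0 - 1) * z := (pow_sub_one_mul (t.2.2 0).ne' z).symm
  have ht := t.cast_ne_zero 0
  simp only [multiPolylogTerm, Fin.prod_univ_succ, Matrix.cons_val_zero, Matrix.cons_val_succ, hpow]
  field_simp
  ring

lemma hasDerivAt_multiPolylog_one (a : Fin (d + 1) → ℕ) (hz : ‖z‖ < 1) :
    HasDerivAt (multiPolylog (vecCons 1 a)) (multiPolylog a z / (1 - z)) z := by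
  obtain ⟨hdiff, hsum⟩ := hasSum_deriv_multiPolylogTerm (vecCons 1 a) hz
  refine hdiff.hasDerivAt.congr_deriv ?_
  rw [← hsum.tsum_eq, ← (DecTuple.consEquiv d).tsum_eq, div_eq_mul_inv,
    ← tsum_geometric_of_norm_lt_one hz, multiPolylog, tsum_mul_tsum_of_summable_norm
      (summable_multiPolylogTerm_of_norm_lt_one a hz).norm
      (by simpa using summable_geometric_of_lt_one (norm_nonneg z) hz)]
  refine tsum_congr fun p => ?_
  have hhead : (((DecTuple.consEquiv d) p).1 0 : ℂ) ≠ 0 := DecTuple.cast_ne_zero _ 0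
  have hexp : ((DecTuple.consEquiv d) p).1 0 - 1 = p.1.1 0 + p.2 := by
    change p.1.1 0 + 1 + p.2 - 1 = _
    omega
  have htail (i : Fin (d + 1)) : ((DecTuple.consEquiv d) p).1 i.succ = p.1.1 i := rfl
  rw [Fin.prod_univ_succ, Matrix.cons_val_zero, pow_one, mul_div_mul_left _ _ hhead, hexp, pow_add]
  simp only [htail, Matrix.cons_val_succ, multiPolylogTerm, div_mul_eq_mul_div]

lemma one_sub_mem_slitPlane (hz : ‖z‖ < 1) : 1 - z ∈ Complex.slitPlane := by
  simpa [sub_eq_add_neg] using Complex.mem_slitPlane_of_norm_lt_one (z := -z) (by simpa using hz)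

lemma multiPolylog_nielsenIndex_one_zero (hz : ‖z‖ < 1) :
    multiPolylog (nielsenIndex 1 0) z = -Complex.log (1 - z) := by
  rw [multiPolylog, ← DecTuple.natEquiv.tsum_eq,
    ← (Complex.hasSum_taylorSeries_neg_log' hz).tsum_eq]
  exact tsum_congr fun n => by simp [multiPolylogTerm, nielsenIndex, DecTuple.natEquiv]

lemma nielsenIndex_one (b : ℕ) : nielsenIndex 1 b = fun _ => 1 :=
  funext <| Fin.cases rfl fun _ => rfl

lemma hasDerivAt_neg_log_one_sub (hz : ‖z‖ < 1) :
    HasDerivAt (fun w => -Complex.log (1 - w)) (1 - z)⁻¹ z := by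
  refine (((hasDerivAt_id z).const_sub 1).clog (one_sub_mem_slitPlane hz)).fun_neg.congr_deriv ?_
  simp [neg_div]

lemma hasDerivAt_pow_div_factorial (n : ℕ) (u : ℂ) :
    HasDerivAt (fun u : ℂ => u ^ (n + 1) / ((n + 1)! : ℂ)) (u ^ n / (n ! : ℂ)) u := by
  refine ((hasDerivAt_pow (n + 1) u).div_const _).congr_deriv ?_
  rw [Nat.factorial_succ, Nat.cast_mul, Nat.add_sub_cancel,
    mul_div_mul_left _ _ (Nat.cast_ne_zero.2 n.succ_ne_zero)]

lemma multiPolylog_nielsenIndex_one (b : ℕ) (hz : ‖z‖ < 1) :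
    multiPolylog (nielsenIndex 1 b) z = (-Complex.log (1 - z)) ^ (b + 1) / ((b + 1)! : ℂ) := by
  induction b generalizing z with
  | zero => simpa using multiPolylog_nielsenIndex_one_zero hz
  | succ b ih =>
    have hLi (w : ℂ) (hw : ‖w‖ < 1) : HasDerivAt (multiPolylog (nielsenIndex 1 (b + 1)))
        (multiPolylog (nielsenIndex 1 b) w / (1 - w)) w := by
      rw [nielsenIndex_one b]
      exact hasDerivAt_multiPolylog_one _ hw
    have hpow (w : ℂ) (hw : ‖w‖ < 1) :
        HasDerivAt (fun w => (-Complex.log (1 - w)) ^ (b + 2) / ((b + 2)! : ℂ))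
          (multiPolylog (nielsenIndex 1 b) w / (1 - w)) w := by
      rw [ih hw, div_eq_mul_inv _ (1 - w)]
      exact (hasDerivAt_pow_div_factorial (b + 1) _).comp w (hasDerivAt_neg_log_one_sub hw)
    refine Metric.isOpen_ball.eqOn_of_deriv_eq (convex_ball (0 : ℂ) 1).isPreconnected
      (fun w hw => (hLi w (mem_ball_zero_iff.1 hw)).differentiableAt.differentiableWithinAt)
      (fun w hw => (hpow w (mem_ball_zero_iff.1 hw)).differentiableAt.differentiableWithinAt)
      (fun w hw => (hLi w (mem_ball_zero_iff.1 hw)).deriv.trans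
        (hpow w (mem_ball_zero_iff.1 hw)).deriv.symm)
      (Metric.mem_ball_self one_pos) ?_ (mem_ball_zero_iff.2 hz)
    simp [multiPolylog_zero]

end Derivative

section LogWeighted

variable {d : ℕ}

/-- The sum `∑_{j ≤ k} u^j / j! · Li_{2+k-j,a}(z)` of polylogarithms weighted by powers of a
logarithm `u`. It is an antiderivative of `u^k / k! · Li_{1,a}(z) dz / z` along every curve
on which `u = -log z`, up to an additive constant. -/
def logWeightedPolylog (k : ℕ) (a : Fin d → ℕ) (u z : ℂ) : ℂ :=
  ∑ j ∈ Finset.range (k + 1), u ^ j / (j ! : ℂ) * multiPolylog (vecCons (2 + k - j) a) z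

lemma logWeightedPolylog_zero_left (k : ℕ) (a : Fin d → ℕ) (z : ℂ) :
    logWeightedPolylog k a 0 z = multiPolylog (vecCons (2 + k) a) z := by
  rw [logWeightedPolylog, Finset.sum_range_succ']
  simp

-- The derivative of the `j`-th summand is `q (T j - T (j - 1))` with `T j = u^j/j! · Li_{1+k-j,a}`.
lemma hasDerivAt_logWeightedPolylog (k : ℕ) (a : Fin d → ℕ) {u z : ℝ → ℂ} {q : ℂ} {t : ℝ}
    (hu : HasDerivAt u (-q) t) (hz : HasDerivAt z (q * z t) t) (hz₁ : ‖z t‖ < 1)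
    (hz₀ : z t ≠ 0) :
    HasDerivAt (fun t => logWeightedPolylog k a (u t) (z t))
      (q * (u t ^ k / (k ! : ℂ)) * multiPolylog (vecCons 1 a) (z t)) t := by
  set T : ℕ → ℂ := fun j => u t ^ j / (j ! : ℂ) * multiPolylog (vecCons (1 + k - j) a) (z t) with hT
  have hLi {j : ℕ} (hj : j ≤ k) : HasDerivAt (fun t => multiPolylog (vecCons (2 + k - j) a) (z t))
      (q * multiPolylog (vecCons (1 + k - j) a) (z t)) t := by
    rw [show 2 + k - j = 1 + k - j + 1 by omega]
    refine ((hasDerivAt_multiPolylog_succ _ a hz₁ hz₀).comp t hz).congr_deriv ?_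
    field_simp
  have hterm (j : ℕ) (hj : j ∈ Finset.range k) : HasDerivAt
      (fun t => u t ^ (j + 1) / ((j + 1)! : ℂ) *
        multiPolylog (vecCons (2 + k - (j + 1)) a) (z t)) (q * (T (j + 1) - T j)) t := by
    refine (((hasDerivAt_pow_div_factorial j (u t)).comp t hu).mul
      (hLi (Finset.mem_range.1 hj))).congr_deriv ?_
    simp only [hT, Function.comp_apply, show 2 + k - (j + 1) = 1 + k - j by omega]
    ring
  simp only [logWeightedPolylog, Finset.sum_range_succ' _ k, pow_zero, Nat.factorial_zero,
    Nat.cast_one, div_one, one_mul]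
  refine ((HasDerivAt.fun_sum hterm).add (hLi k.zero_le)).congr_deriv ?_
  rw [← Finset.mul_sum, Finset.sum_range_sub]
  simp only [hT, Nat.add_sub_cancel, Nat.sub_zero, pow_zero, Nat.factorial_zero, Nat.cast_one]
  ring

lemma tendsto_logWeightedPolylog {α : Type*} {l : Filter α} (k : ℕ) {a : Fin d → ℕ}
    (ha : ∀ i, 1 ≤ a i) {u z : α → ℂ} {u₀ z₀ : ℂ} (hu : Tendsto u l (𝓝 u₀))
    (hz : Tendsto z l (𝓝 z₀)) (hz₀ : ‖z₀‖ ≤ 1) (hz₁ : ∀ᶠ x in l, ‖z x‖ ≤ 1) :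
    Tendsto (fun x => logWeightedPolylog k a (u x) (z x)) l
      (𝓝 (logWeightedPolylog k a u₀ z₀)) := by
  refine tendsto_finsetSum _ fun j hj => ((hu.pow j).div_const _).mul ?_
  have hs : 2 ≤ 2 + k - j := by grind
  have hcont := continuousOn_multiPolylog (a := vecCons (2 + k - j) a) hs
    (Fin.cases (one_le_two.trans hs) ha) z₀ (by simpa using hz₀)
  exact hcont.tendsto.comp (tendsto_nhdsWithin_iff.2 ⟨hz, by simpa using hz₁⟩)

-- The polylogarithm vanishes to first order at `0`, which beats any power of the logarithm.
lemma tendsto_log_pow_mul_multiPolylog (j : ℕ) (a : Fin (d + 1) → ℕ) :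
    Tendsto (fun x : ℝ => (-(Real.log x : ℂ)) ^ j * multiPolylog a x) (𝓝[>] 0) (𝓝 0) := by
  have hlog : (fun x : ℝ => (-(Real.log x : ℂ)) ^ j) =o[𝓝[>] 0] fun x : ℝ => x⁻¹ := by
    have h := isLittleO_abs_log_rpow_rpow_nhdsGT_zero (s := -1) (j : ℝ) (by norm_num)
    simp only [Real.rpow_natCast, Real.rpow_neg_one] at h
    refine h.norm_left.congr_left (fun x => ?_) |>.of_norm_left
    simp
  have hLi : (fun x : ℝ => multiPolylog a x) =O[𝓝[>] 0] fun x : ℝ => x := by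
    have h := (differentiableAt_multiPolylog a (z := 0) (by simp)).isBigO_sub
    simp only [multiPolylog_zero, sub_zero] at h
    have ht : Tendsto (fun x : ℝ => (x : ℂ)) (𝓝[>] 0) (𝓝 0) :=
      (Complex.continuous_ofReal.tendsto' 0 0 (by simp)).mono_left nhdsWithin_le_nhds
    exact (h.comp_tendsto ht).trans (Asymptotics.isBigO_of_le _ fun x => by simp)
  refine (Asymptotics.isLittleO_one_iff ℝ).1 <| (hlog.mul_isBigO hLi).congr' .rfl ?_
  filter_upwards [self_mem_nhdsWithin] with x hx using inv_mul_cancel₀ (mem_Ioi.1 hx).ne'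

lemma tendsto_logWeightedPolylog_neg_log (k : ℕ) (a : Fin d → ℕ) :
    Tendsto (fun x : ℝ => logWeightedPolylog k a (-(Real.log x : ℂ)) x) (𝓝[>] 0) (𝓝 0) := by
  have h : Tendsto (fun x : ℝ => logWeightedPolylog k a (-(Real.log x : ℂ)) x) (𝓝[>] 0)
      (𝓝 (∑ j ∈ Finset.range (k + 1), 0 / (j ! : ℂ))) :=
    tendsto_finsetSum _ fun j _ => ((tendsto_log_pow_mul_multiPolylog j _).div_const _).congr
      fun x => mul_div_right_comm _ _ _
  simpa using h

lemma tendsto_logWeightedPolylog_neg_log_one_sub (k : ℕ) {a : Fin d → ℕ} (ha : ∀ i, 1 ≤ a i) :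
    Tendsto (fun x : ℝ => logWeightedPolylog k a (-(Real.log (1 - x) : ℂ)) ((1 - x : ℝ) : ℂ))
      (𝓝[>] 0) (𝓝 (multiPolylog (vecCons (2 + k) a) 1)) := by
  rw [← logWeightedPolylog_zero_left]
  have hx : Tendsto (fun x : ℝ => 1 - x) (𝓝[>] 0) (𝓝 1) :=
    ((continuous_const.sub continuous_id).tendsto' 0 1 (by simp)).mono_left nhdsWithin_le_nhds
  refine tendsto_logWeightedPolylog k ha ?_ (by simpa using hx.ofReal) (by simp) ?_
  · simpa using ((Real.continuousAt_log one_ne_zero).tendsto.comp hx).ofReal.neg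
  · filter_upwards [Ioo_mem_nhdsGT (zero_lt_one (α := ℝ))] with x hx
    rw [Complex.norm_of_nonneg (sub_nonneg.2 hx.2.le)]
    exact sub_le_self 1 hx.1.le

end LogWeighted

section Duality

variable {x : ℝ}

/-- The expression `S_{k,b}(x) + S_{b,k}(1 - x) + log(1/x)^{k+1} log(1/(1-x))^{b+1} / (k+1)!(b+1)!`,
where `S_{k,b}(x) = ∑_{j ≤ k} log(1/x)^j / j! · Li_{2+k-j,{1}^b}(x)`. It is constant on `(0, 1)`,
and its limits at the two end points are the two sides of the duality of zeta values. -/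
def nielsenDual (k b : ℕ) (x : ℝ) : ℂ :=
  logWeightedPolylog k (1 : Fin b → ℕ) (-(Real.log x : ℂ)) x +
    logWeightedPolylog b (1 : Fin k → ℕ) (-(Real.log (1 - x) : ℂ)) ((1 - x : ℝ) : ℂ) +
    (-(Real.log x : ℂ)) ^ (k + 1) / ((k + 1)! : ℂ) *
      ((-(Real.log (1 - x) : ℂ)) ^ (b + 1) / ((b + 1)! : ℂ))

lemma nielsenDual_one_sub (k b : ℕ) (x : ℝ) : nielsenDual k b (1 - x) = nielsenDual b k x := by
  simp only [nielsenDual, sub_sub_cancel]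
  ring

lemma one_sub_mem_Ioo (hx : x ∈ Ioo (0 : ℝ) 1) : 1 - x ∈ Ioo (0 : ℝ) 1 :=
  ⟨sub_pos.2 hx.2, sub_lt_self 1 hx.1⟩

lemma multiPolylog_nielsenIndex_one_ofReal (b : ℕ) (hx : x ∈ Ioo (0 : ℝ) 1) :
    multiPolylog (nielsenIndex 1 b) x =
      (-(Real.log (1 - x) : ℂ)) ^ (b + 1) / ((b + 1)! : ℂ) := by
  rw [multiPolylog_nielsenIndex_one b ((Complex.norm_of_nonneg hx.1.le).trans_lt hx.2),
    Complex.ofReal_log (sub_nonneg.2 hx.2.le), Complex.ofReal_sub, Complex.ofReal_one]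

lemma tendsto_nielsenDual (k b : ℕ) :
    Tendsto (nielsenDual k b) (𝓝[>] 0) (𝓝 (multiZeta (nielsenIndex (2 + b) k))) := by
  have hprod : Tendsto (fun x : ℝ => (-(Real.log x : ℂ)) ^ (k + 1) / ((k + 1)! : ℂ) *
      ((-(Real.log (1 - x) : ℂ)) ^ (b + 1) / ((b + 1)! : ℂ))) (𝓝[>] 0) (𝓝 0) := by
    have h := (tendsto_log_pow_mul_multiPolylog (k + 1) (nielsenIndex 1 b)).div_const
      ((k + 1)! : ℂ)
    rw [zero_div] at h
    refine h.congr' ?_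
    filter_upwards [Ioo_mem_nhdsGT (zero_lt_one (α := ℝ))] with x hx
    rw [multiPolylog_nielsenIndex_one_ofReal b hx, mul_div_right_comm]
  have h := ((tendsto_logWeightedPolylog_neg_log k (1 : Fin b → ℕ)).add
    (tendsto_logWeightedPolylog_neg_log_one_sub b (a := (1 : Fin k → ℕ)) fun _ => le_rfl)).add hprod
  rwa [zero_add, add_zero] at h

lemma hasDerivAt_neg_log_ofReal (hx : x ≠ 0) :
    HasDerivAt (fun x : ℝ => -(Real.log x : ℂ)) (-(x : ℂ)⁻¹) x := by
  simpa using (Real.hasDerivAt_log hx).ofReal_comp.fun_neg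

lemma hasDerivAt_logWeightedPolylog_neg_log (k b : ℕ) (hx : x ∈ Ioo (0 : ℝ) 1) :
    HasDerivAt (fun x : ℝ => logWeightedPolylog k (1 : Fin b → ℕ) (-(Real.log x : ℂ)) x)
      ((x : ℂ)⁻¹ * ((-(Real.log x : ℂ)) ^ k / (k ! : ℂ)) *
        ((-(Real.log (1 - x) : ℂ)) ^ (b + 1) / ((b + 1)! : ℂ))) x := by
  have hx₀ : (x : ℂ) ≠ 0 := Complex.ofReal_ne_zero.2 hx.1.ne'
  rw [← multiPolylog_nielsenIndex_one_ofReal b hx]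
  refine hasDerivAt_logWeightedPolylog k _ (hasDerivAt_neg_log_ofReal hx.1.ne') ?_
    ((Complex.norm_of_nonneg hx.1.le).trans_lt hx.2) hx₀
  rw [inv_mul_cancel₀ hx₀]
  exact (hasDerivAt_id x).ofReal_comp

lemma hasDerivAt_neg_log_pow_div_factorial (k : ℕ) (hx : x ≠ 0) :
    HasDerivAt (fun x : ℝ => (-(Real.log x : ℂ)) ^ (k + 1) / ((k + 1)! : ℂ))
      ((-(Real.log x : ℂ)) ^ k / (k ! : ℂ) * -(x : ℂ)⁻¹) x :=
  HasDerivAt.comp x (hasDerivAt_pow_div_factorial k _) (hasDerivAt_neg_log_ofReal hx)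

lemma hasDerivAt_nielsenDual (k b : ℕ) (hx : x ∈ Ioo (0 : ℝ) 1) :
    HasDerivAt (nielsenDual k b) 0 x := by
  have hx' := one_sub_mem_Ioo hx
  refine (((hasDerivAt_logWeightedPolylog_neg_log k b hx).add
    ((hasDerivAt_logWeightedPolylog_neg_log b k hx').comp_const_sub 1 x)).add
    ((hasDerivAt_neg_log_pow_div_factorial k hx.1.ne').mul
      ((hasDerivAt_neg_log_pow_div_factorial b hx'.1.ne').comp_const_sub 1 x))).congr_deriv ?_
  simp only [sub_sub_cancel]
  ring

theorem multiZeta_nielsenIndex_duality (k b : ℕ) :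
    multiZeta (nielsenIndex (2 + k) b) = multiZeta (nielsenIndex (2 + b) k) := by
  have hconst (k b : ℕ) :
      ∀ᶠ x in 𝓝[>] (0 : ℝ), nielsenDual k b x = nielsenDual k b (1 / 2) := by
    filter_upwards [Ioo_mem_nhdsGT (zero_lt_one (α := ℝ))] with x hx
    exact isOpen_Ioo.is_const_of_deriv_eq_zero isPreconnected_Ioo
      (fun y hy => (hasDerivAt_nielsenDual k b hy).differentiableAt.differentiableWithinAt)
      (fun y hy => (hasDerivAt_nielsenDual k b hy).deriv) hx (by norm_num)
  have hvalue (k b : ℕ) : nielsenDual k b (1 / 2) = multiZeta (nielsenIndex (2 + b) k) :=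
    tendsto_nhds_unique (tendsto_const_nhds.congr' ((hconst k b).mono fun _ h => h.symm))
      (tendsto_nielsenDual k b)
  calc multiZeta (nielsenIndex (2 + k) b) = nielsenDual b k (1 / 2) := (hvalue b k).symm
    _ = nielsenDual k b (1 / 2) := by rw [← nielsenDual_one_sub]; norm_num
    _ = multiZeta (nielsenIndex (2 + b) k) := hvalue k b

end Duality

section LogSineBound

variable {θ τ : ℝ}

/-- A function on `(0, 2π)` dominating `|log (1 - r e^{iθ})|` for all `0 ≤ r ≤ 1`; the summand `π`
accounts for the imaginary part of the logarithm. -/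
def logSineBound (θ : ℝ) : ℝ := Real.log (2 / Real.sin (θ / 2)) + π

lemma sin_half_pos (hθ : θ ∈ Ioo 0 (2 * π)) : 0 < Real.sin (θ / 2) :=
  Real.sin_pos_of_pos_of_lt_pi (by linarith [hθ.1]) (by linarith [hθ.2])

lemma abs_log_add_pi_le_logSineBound {x : ℝ} (hθ : θ ∈ Ioo 0 (2 * π))
    (hx : Real.sin (θ / 2) ≤ x) (hx₂ : x ≤ 2) : |Real.log x| + π ≤ logSineBound θ := by
  have hs := sin_half_pos hθ
  have hlog_sin := Real.log_nonpos hs.le (Real.sin_le_one _)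
  have hlog_lower := Real.log_le_log hs hx
  have hlog_upper := Real.log_le_log (hs.trans_le hx) hx₂
  have hlog_two := Real.log_nonneg (one_le_two (α := ℝ))
  rw [logSineBound, Real.log_div two_ne_zero hs.ne']
  gcongr
  exact abs_le.2 ⟨by linarith, by linarith⟩

lemma logSineBound_nonneg (hθ : θ ∈ Ioo 0 (2 * π)) : 0 ≤ logSineBound θ :=
  (by positivity : 0 ≤ |Real.log (Real.sin (θ / 2))| + π).trans <|
    abs_log_add_pi_le_logSineBound hθ le_rfl ((Real.sin_le_one _).trans one_le_two)

lemma min_div_pi_le_sin_half (hθ : θ ∈ Icc 0 (2 * π)) :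
    min θ (2 * π - θ) / π ≤ Real.sin (θ / 2) := by
  have hJordan {y : ℝ} (hy : 0 ≤ y) (hy' : y ≤ π) : y / π ≤ Real.sin (y / 2) := by
    convert Real.mul_le_sin (x := y / 2) (by linarith) (by linarith) using 1
    ring
  rcases le_total θ π with h | h
  · rw [min_eq_left (by linarith)]
    exact hJordan hθ.1 h
  · rw [min_eq_right (by linarith), ← Real.sin_pi_sub, show π - θ / 2 = (2 * π - θ) / 2 by ring]
    exact hJordan (by linarith [hθ.2]) (by linarith)

lemma rpow_inv_sin_half_le (hθ : θ ∈ Ioo 0 (2 * π)) :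
    (2 / Real.sin (θ / 2)) ^ (1 / 2 : ℝ) ≤
      (2 * π) ^ (1 / 2 : ℝ) * (θ ^ (-(1 / 2) : ℝ) + (2 * π - θ) ^ (-(1 / 2) : ℝ)) := by
  have hθ₀ : 0 < θ := hθ.1
  have hθ₁ : 0 < 2 * π - θ := sub_pos.2 hθ.2
  have hmin : 0 < min θ (2 * π - θ) := lt_min hθ₀ hθ₁
  have hs := sin_half_pos hθ
  calc (2 / Real.sin (θ / 2)) ^ (1 / 2 : ℝ)
      ≤ (2 / (min θ (2 * π - θ) / π)) ^ (1 / 2 : ℝ) := by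
        gcongr
        exact min_div_pi_le_sin_half (Ioo_subset_Icc_self hθ)
    _ = (2 * π) ^ (1 / 2 : ℝ) * min θ (2 * π - θ) ^ (-(1 / 2) : ℝ) := by
        rw [Real.rpow_neg hmin.le, ← Real.inv_rpow hmin.le,
          ← Real.mul_rpow (by positivity) (by positivity)]
        congr 1
        field_simp
    _ ≤ _ := by
        gcongr
        rcases min_choice θ (2 * π - θ) with h | h <;> rw [h]
        · exact le_add_of_nonneg_right (by positivity)
        · exact le_add_of_nonneg_left (by positivity)

-- From `x ^ p / p! ≤ exp x` at `x = logSineBound θ / 2`.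
lemma logSineBound_pow_le (p : ℕ) (hθ : θ ∈ Ioo 0 (2 * π)) :
    logSineBound θ ^ p ≤
      2 ^ p * p ! * Real.exp (π / 2) * (2 / Real.sin (θ / 2)) ^ (1 / 2 : ℝ) := by
  have hs := sin_half_pos hθ
  have hexp : Real.exp (logSineBound θ / 2) =
      Real.exp (π / 2) * (2 / Real.sin (θ / 2)) ^ (1 / 2 : ℝ) := by
    rw [Real.rpow_def_of_pos (by positivity), ← Real.exp_add, logSineBound]
    ring_nf
  have hB := logSineBound_nonneg hθ
  calc logSineBound θ ^ p = 2 ^ p * p ! * ((logSineBound θ / 2) ^ p / p !) := by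
        rw [div_pow]
        field_simp
    _ ≤ 2 ^ p * p ! * Real.exp (logSineBound θ / 2) := by
        gcongr
        exact Real.pow_div_factorial_le_exp _ (by positivity) p
    _ = 2 ^ p * p ! * Real.exp (π / 2) * (2 / Real.sin (θ / 2)) ^ (1 / 2 : ℝ) := by
        rw [hexp, mul_assoc _ (Real.exp _)]

lemma intervalIntegrable_logSineBound_pow (p : ℕ) :
    IntervalIntegrable (fun θ => logSineBound θ ^ p) volume 0 (2 * π) := by
  have hrpow (a b : ℝ) : IntervalIntegrable (fun θ : ℝ => θ ^ (-(1 / 2) : ℝ)) volume a b :=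
    intervalIntegral.intervalIntegrable_rpow' (by norm_num)
  have hrpow' : IntervalIntegrable (fun θ : ℝ => (2 * π - θ) ^ (-(1 / 2) : ℝ)) volume
      0 (2 * π) := by
    simpa using (hrpow (2 * π) 0).comp_sub_left (2 * π)
  refine ((((hrpow _ _).add hrpow').const_mul ((2 * π) ^ (1 / 2 : ℝ))).const_mul
    (2 ^ p * p ! * Real.exp (π / 2))).mono_fun' ?_ ?_
  · refine Measurable.aestronglyMeasurable ?_
    unfold logSineBound
    fun_prop
  · rw [uIoc_of_le (by positivity), ← restrict_Ioo_eq_restrict_Ioc]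
    filter_upwards [ae_restrict_mem measurableSet_Ioo] with θ hθ
    rw [Real.norm_of_nonneg (pow_nonneg (logSineBound_nonneg hθ) _)]
    exact (logSineBound_pow_le p hθ).trans
      (mul_le_mul_of_nonneg_left (rpow_inv_sin_half_le hθ) (by positivity))

lemma ae_mem_Ioo_of_mem_uIoc (hτ₀ : 0 ≤ τ) (hτ : τ ≤ 2 * π) :
    ∀ᵐ θ, θ ∈ uIoc 0 τ → θ ∈ Ioo 0 (2 * π) := by
  filter_upwards [compl_mem_ae_iff.2 (measure_singleton (2 * π))] with θ hne hθ
  rw [uIoc_of_le hτ₀] at hθ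
  exact ⟨hθ.1, (hθ.2.trans hτ).lt_of_ne hne⟩

lemma intervalIntegrable_logSineBound_pow_of_le (p : ℕ) (hτ₀ : 0 ≤ τ) (hτ : τ ≤ 2 * π) :
    IntervalIntegrable (fun θ => logSineBound θ ^ p) volume 0 τ :=
  (intervalIntegrable_logSineBound_pow p).mono_set (uIcc_subset_uIcc_left (by
    rw [uIcc_of_le (hτ₀.trans hτ)]
    exact ⟨hτ₀, hτ⟩))

lemma intervalIntegrable_logSineIntegrand (n k : ℕ) (hτ₀ : 0 ≤ τ) (hτ : τ ≤ 2 * π) :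
    IntervalIntegrable (logSineIntegrand n k) volume 0 τ := by
  have hlog : IntervalIntegrable (fun θ => Real.log |2 * Real.sin (θ / 2)| ^ (n - 1 - k))
      volume 0 τ := by
    refine (intervalIntegrable_logSineBound_pow_of_le (n - 1 - k) hτ₀ hτ).mono_fun' ?_ ?_
    · exact Measurable.aestronglyMeasurable (by fun_prop)
    · refine (ae_restrict_iff' measurableSet_uIoc).2 ?_
      filter_upwards [ae_mem_Ioo_of_mem_uIoc hτ₀ hτ] with θ hmem hθ
      have hs := sin_half_pos (hmem hθ)
      have habs : |2 * Real.sin (θ / 2)| = 2 * Real.sin (θ / 2) := abs_of_pos (by positivity)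
      have hbound := abs_log_add_pi_le_logSineBound (hmem hθ) (x := 2 * Real.sin (θ / 2))
        (by linarith) (by linarith [Real.sin_le_one (θ / 2)])
      rw [norm_pow, Real.norm_eq_abs, habs]
      gcongr
      linarith [Real.pi_pos]
  exact hlog.continuousOn_mul (continuous_pow k).continuousOn

end LogSineBound

section LogOneSub

variable {r θ : ℝ}

lemma norm_ofReal_mul_exp_I_mul (hr : 0 ≤ r) (θ : ℝ) : ‖r * Complex.exp (I * θ)‖ = r := by
  rw [norm_mul, Complex.norm_exp_I_mul_ofReal, mul_one, Complex.norm_of_nonneg hr]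

-- `(1 + r) sin(θ/2)` is minus the imaginary part of `e^{-iθ/2} (1 - r e^{iθ})`.
lemma sin_half_le_norm_one_sub (hr : 0 ≤ r) (hθ : θ ∈ Ioo 0 (2 * π)) :
    Real.sin (θ / 2) ≤ ‖1 - r * Complex.exp (I * θ)‖ := by
  have hrotate : Complex.exp ((-(θ / 2) : ℝ) * I) * (1 - r * Complex.exp (I * θ)) =
      Complex.exp ((-(θ / 2) : ℝ) * I) - r * Complex.exp ((θ / 2 : ℝ) * I) := by
    rw [mul_sub, mul_one, mul_left_comm, ← Complex.exp_add]
    congr 3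
    push_cast
    ring
  have him : (Complex.exp ((-(θ / 2) : ℝ) * I) - r * Complex.exp ((θ / 2 : ℝ) * I)).im =
      -((1 + r) * Real.sin (θ / 2)) := by
    rw [Complex.sub_im, Complex.im_ofReal_mul, Complex.exp_ofReal_mul_I_im,
      Complex.exp_ofReal_mul_I_im, Real.sin_neg]
    ring
  calc Real.sin (θ / 2) ≤ (1 + r) * Real.sin (θ / 2) :=
        le_mul_of_one_le_left (sin_half_pos hθ).le (le_add_of_nonneg_right hr)
    _ ≤ |(Complex.exp ((-(θ / 2) : ℝ) * I) - r * Complex.exp ((θ / 2 : ℝ) * I)).im| := by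
        rw [him, abs_neg]
        exact le_abs_self _
    _ ≤ ‖Complex.exp ((-(θ / 2) : ℝ) * I) * (1 - r * Complex.exp (I * θ))‖ := by
        rw [hrotate]
        exact Complex.abs_im_le_norm _
    _ = ‖1 - r * Complex.exp (I * θ)‖ := by
        rw [norm_mul, Complex.norm_exp_ofReal_mul_I, one_mul]

lemma norm_log_one_sub_le (hr : r ∈ Icc (0 : ℝ) 1) (hθ : θ ∈ Ioo 0 (2 * π)) :
    ‖Complex.log (1 - r * Complex.exp (I * θ))‖ ≤ logSineBound θ := by
  have hle : ‖1 - r * Complex.exp (I * θ)‖ ≤ 2 := by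
    refine (norm_sub_le _ _).trans ?_
    rw [norm_ofReal_mul_exp_I_mul hr.1, norm_one]
    linarith [hr.2]
  refine (Complex.norm_le_abs_re_add_abs_im _).trans ?_
  rw [Complex.log_re, Complex.log_im]
  exact (add_le_add_right (Complex.abs_arg_le_pi _) _).trans
    (abs_log_add_pi_le_logSineBound hθ (sin_half_le_norm_one_sub hr.1 hθ) hle)

lemma one_sub_exp_I_mul (θ : ℝ) : 1 - Complex.exp (I * θ) =
    ((2 * Real.sin (θ / 2) : ℝ) : ℂ) * Complex.exp (((θ - π) / 2 : ℝ) * I) := by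
  obtain ⟨y, rfl⟩ : ∃ y, θ = 2 * y := ⟨θ / 2, by ring⟩
  rw [mul_comm I, Complex.exp_mul_I, Complex.exp_mul_I, ← Complex.ofReal_cos,
    ← Complex.ofReal_sin, ← Complex.ofReal_cos, ← Complex.ofReal_sin,
    show (2 * y - π) / 2 = y - π / 2 by ring, Real.cos_sub_pi_div_two,
    Real.sin_sub_pi_div_two, mul_div_cancel_left₀ _ (two_ne_zero' ℝ), Real.sin_two_mul,
    Real.cos_two_mul']
  push_cast
  linear_combination -Complex.sin_sq_add_cos_sq (y : ℂ)

lemma log_one_sub_exp_I_mul (hθ : θ ∈ Ioo 0 (2 * π)) :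
    Complex.log (1 - Complex.exp (I * θ)) =
      Real.log |2 * Real.sin (θ / 2)| + I / 2 * (θ + -π) := by
  have hs := sin_half_pos hθ
  have hπ := Real.pi_pos
  have him : (((θ - π) / 2 : ℝ) * I).im = (θ - π) / 2 := by simp
  rw [one_sub_exp_I_mul, Complex.log_ofReal_mul (by positivity) (Complex.exp_ne_zero _),
    Complex.log_exp, abs_of_pos (by positivity)]
  · push_cast
    ring
  · linarith [hθ.1]
  · linarith [hθ.2]

lemma one_sub_exp_I_mul_mem_slitPlane (hθ : θ ∈ Ioo 0 (2 * π)) :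
    1 - Complex.exp (I * θ) ∈ Complex.slitPlane := by
  have hcos : Real.cos θ ≠ 1 := fun h =>
    hθ.1.ne' ((Real.cos_eq_one_iff_of_lt_of_lt (by linarith [hθ.1, Real.pi_pos]) hθ.2).1 h)
  refine Or.inl ?_
  rw [Complex.sub_re, mul_comm, Complex.exp_ofReal_mul_I_re, Complex.one_re]
  exact sub_pos.2 ((Real.cos_le_one θ).lt_of_ne hcos)

end LogOneSub

section CircleIntegral

variable {d : ℕ} {r τ : ℝ}

lemma logWeightedPolylog_sub_eq_integral (k : ℕ) (a : Fin d → ℕ) (hr : r ∈ Ioo (0 : ℝ) 1) (τ : ℝ) :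
    logWeightedPolylog k a (-I * τ) (r * Complex.exp (I * τ)) - multiPolylog (vecCons (2 + k) a) r =
      ∫ t in (0 : ℝ)..τ, I * ((-I * t) ^ k / (k ! : ℂ)) *
        multiPolylog (vecCons 1 a) (r * Complex.exp (I * t)) := by
  have hnorm (t : ℝ) : ‖r * Complex.exp (I * t)‖ < 1 :=
    (norm_ofReal_mul_exp_I_mul hr.1.le t).trans_lt hr.2
  have hmul (c : ℂ) (t : ℝ) : HasDerivAt (fun t : ℝ => c * (t : ℂ)) c t := by
    simpa using (hasDerivAt_id t).ofReal_comp.const_mul c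
  have hz (t : ℝ) : HasDerivAt (fun t : ℝ => r * Complex.exp (I * t))
      (I * (r * Complex.exp (I * t))) t :=
    ((hmul I t).cexp.const_mul (r : ℂ)).congr_deriv (by ring)
  have hcont : Continuous fun t : ℝ => multiPolylog (vecCons 1 a) (r * Complex.exp (I * t)) :=
    continuous_iff_continuousAt.2 fun t =>
      (differentiableAt_multiPolylog _ (hnorm t)).continuousAt.comp_of_eq (hz t).continuousAt rfl
  rw [intervalIntegral.integral_eq_sub_of_hasDerivAt (fun t _ =>
    hasDerivAt_logWeightedPolylog k a (hmul (-I) t) (hz t) (hnorm t)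
      (mul_ne_zero (Complex.ofReal_ne_zero.2 hr.1.ne') (Complex.exp_ne_zero _)))
    (Continuous.intervalIntegrable (by fun_prop) _ _)]
  simp [logWeightedPolylog_zero_left]

lemma tendsto_logWeightedPolylog_radial (k : ℕ) {a : Fin d → ℕ} (ha : ∀ i, 1 ≤ a i) (u : ℂ)
    (τ : ℝ) :
    Tendsto (fun r : ℝ => logWeightedPolylog k a u (r * Complex.exp (I * τ))) (𝓝[<] 1)
      (𝓝 (logWeightedPolylog k a u (Complex.exp (I * τ)))) := by
  refine tendsto_logWeightedPolylog k ha tendsto_const_nhds ?_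
    (Complex.norm_exp_I_mul_ofReal τ).le ?_
  · refine ((Complex.continuous_ofReal.mul continuous_const).tendsto' 1 _ ?_).mono_left
      nhdsWithin_le_nhds
    simp
  · filter_upwards [Ioo_mem_nhdsLT (zero_lt_one (α := ℝ))] with r hr
    exact (norm_ofReal_mul_exp_I_mul hr.1.le τ).trans_le hr.2.le

lemma tendsto_integral_log_one_sub_pow {f : ℝ → ℂ} (hf : Continuous f) (p : ℕ) (hτ₀ : 0 ≤ τ)
    (hτ : τ ≤ 2 * π) :
    Tendsto (fun r : ℝ => ∫ t in (0 : ℝ)..τ,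
        f t * (-Complex.log (1 - r * Complex.exp (I * t))) ^ p) (𝓝[<] 1)
      (𝓝 (∫ t in (0 : ℝ)..τ, f t * (-Complex.log (1 - Complex.exp (I * t))) ^ p)) := by
  refine intervalIntegral.tendsto_integral_filter_of_dominated_convergence
    (fun t => ‖f t‖ * logSineBound t ^ p)
    (.of_forall fun r => Measurable.aestronglyMeasurable (by fun_prop)) ?_
    ((intervalIntegrable_logSineBound_pow_of_le p hτ₀ hτ).continuousOn_mul hf.norm.continuousOn) ?_
  · filter_upwards [Ioo_mem_nhdsLT (zero_lt_one (α := ℝ))] with r hr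
    filter_upwards [ae_mem_Ioo_of_mem_uIoc hτ₀ hτ] with t hmem ht
    rw [norm_mul, norm_pow, norm_neg]
    gcongr
    exact norm_log_one_sub_le (Ioo_subset_Icc_self hr) (hmem ht)
  · filter_upwards [ae_mem_Ioo_of_mem_uIoc hτ₀ hτ] with t hmem ht
    refine ((Tendsto.clog ?_ (one_sub_exp_I_mul_mem_slitPlane (hmem ht))).neg.pow p).const_mul _
    refine ((continuous_const.sub (Complex.continuous_ofReal.mul continuous_const)).tendsto' 1 _
      ?_).mono_left nhdsWithin_le_nhds
    simp

lemma logWeightedPolylog_exp_sub_eq_integral (k b : ℕ) (hτ₀ : 0 ≤ τ) (hτ : τ ≤ 2 * π) :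
    logWeightedPolylog k (1 : Fin b → ℕ) (-I * τ) (Complex.exp (I * τ)) -
        multiZeta (nielsenIndex (2 + k) b) =
      ∫ t in (0 : ℝ)..τ, I * ((-I * t) ^ k / (k ! : ℂ)) / ((b + 1)! : ℂ) *
        (-Complex.log (1 - Complex.exp (I * t))) ^ (b + 1) := by
  have hradial := tendsto_logWeightedPolylog_radial k (a := (1 : Fin b → ℕ)) (fun _ => le_rfl)
  have hzeta := hradial 0 0
  simp only [logWeightedPolylog_zero_left, Complex.ofReal_zero, mul_zero, Complex.exp_zero,
    mul_one] at hzeta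
  refine tendsto_nhds_unique ((hradial (-I * τ) τ).sub hzeta)
    ((tendsto_integral_log_one_sub_pow (by fun_prop) (b + 1) hτ₀ hτ).congr' ?_)
  filter_upwards [Ioo_mem_nhdsLT (zero_lt_one (α := ℝ))] with r hr
  rw [logWeightedPolylog_sub_eq_integral k _ hr]
  refine intervalIntegral.integral_congr fun t _ => ?_
  have hLi := multiPolylog_nielsenIndex_one b
    ((norm_ofReal_mul_exp_I_mul hr.1.le t).trans_lt hr.2)
  change _ = _ * multiPolylog (nielsenIndex 1 b) _
  simp only [hLi]
  ring

end CircleIntegral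

section Expansion

lemma multinom3_eq {k p r m : ℕ} (hr : r ≤ p) (hm : m ≤ r) :
    (multinom3 (k + p) k m (r - m) : ℂ) =
      (k + p)! / (k ! * p ! : ℂ) * (r.choose m * p.choose r) := by
  have hfac (n : ℕ) : (n ! : ℂ) ≠ 0 := Nat.cast_ne_zero.2 n.factorial_ne_zero
  rw [multinom3, Nat.cast_choose ℂ hr, Nat.cast_choose ℂ hm,
    show k + p - k - m - (r - m) = p - r by omega]
  push_cast
  field_simp [hfac]

lemma sum_multinom3_mul (k p : ℕ) (c x y L : ℂ) :
    ∑ r ∈ Finset.range (p + 1), ∑ m ∈ Finset.range (r + 1),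
        (multinom3 (k + p) k m (r - m) : ℂ) * c ^ r * y ^ (r - m) * (x ^ (k + m) * L ^ (p - r)) =
      (k + p)! / (k ! * p ! : ℂ) * (x ^ k * (L + c * (x + y)) ^ p) := by
  rw [add_comm L, add_pow, Finset.mul_sum, Finset.mul_sum]
  refine Finset.sum_congr rfl fun r hr => ?_
  rw [mul_pow, add_pow x, Finset.mul_sum, Finset.sum_mul, Finset.sum_mul, Finset.mul_sum,
    Finset.mul_sum]
  refine Finset.sum_congr rfl fun m hm => ?_
  rw [multinom3_eq (Finset.mem_range_succ_iff.1 hr) (Finset.mem_range_succ_iff.1 hm)]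
  ring

variable {τ : ℝ}

lemma ofReal_logSine (n k : ℕ) (τ : ℝ) :
    (logSine n k τ : ℂ) = -∫ t in (0 : ℝ)..τ, (logSineIntegrand n k t : ℂ) := by
  rw [logSine, intervalIntegral.integral_ofReal, Complex.ofReal_neg]

lemma intervalIntegral_sum_ofReal_logSineIntegrand {ι : Type*} (s : Finset ι) (c : ι → ℂ)
    (n k : ι → ℕ) (hτ₀ : 0 ≤ τ) (hτ : τ ≤ 2 * π) :
    ∫ t in (0 : ℝ)..τ, ∑ i ∈ s, c i * (logSineIntegrand (n i) (k i) t : ℂ) =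
      -∑ i ∈ s, c i * (logSine (n i) (k i) τ : ℂ) := by
  have hint (i : ι) :
      IntervalIntegrable (fun t => (logSineIntegrand (n i) (k i) t : ℂ)) volume 0 τ :=
    have h := intervalIntegrable_logSineIntegrand (n i) (k i) hτ₀ hτ
    ⟨h.1.ofReal, h.2.ofReal⟩
  rw [intervalIntegral.integral_finsetSum fun i _ => (hint i).const_mul (c i)]
  simp only [intervalIntegral.integral_const_mul, ofReal_logSine, mul_neg, Finset.sum_neg_distrib,
    neg_neg]

lemma integral_pow_mul_log_one_sub_exp_pow (k p : ℕ) (hτ₀ : 0 ≤ τ) (hτ : τ ≤ 2 * π) :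
    ((k + p)! / (k ! * p ! : ℂ)) *
        ∫ t in (0 : ℝ)..τ, (t : ℂ) ^ k * Complex.log (1 - Complex.exp (I * t)) ^ p =
      -∑ r ∈ Finset.range (p + 1), ∑ m ∈ Finset.range (r + 1),
        (multinom3 (k + p) k m (r - m) : ℂ) * (I / 2) ^ r * (-(π : ℂ)) ^ (r - m) *
          (logSine (k + p + 1 - (r - m)) (k + m) τ : ℂ) := by
  rw [Finset.sum_sigma', ← intervalIntegral_sum_ofReal_logSineIntegrand _ _ _ _ hτ₀ hτ,
    ← intervalIntegral.integral_const_mul]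
  refine intervalIntegral.integral_congr_ae ?_
  filter_upwards [ae_mem_Ioo_of_mem_uIoc hτ₀ hτ] with t hmem ht
  rw [log_one_sub_exp_I_mul (hmem ht), ← sum_multinom3_mul, Finset.sum_sigma']
  refine Finset.sum_congr rfl fun i hi => ?_
  obtain ⟨hr, hm⟩ := Finset.mem_sigma.1 hi
  rw [logSineIntegrand, show k + p + 1 - (i.1 - i.2) - 1 - (k + i.2) = p - i.1 by grind]
  push_cast
  rfl

theorem multiZeta_sub_logWeightedPolylog_eq_sum_logSine (k b : ℕ) (hτ₀ : 0 ≤ τ)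
    (hτ : τ ≤ 2 * π) :
    multiZeta (nielsenIndex (b + 2) k) -
        logWeightedPolylog k (1 : Fin b → ℕ) (-I * τ) (Complex.exp (I * τ)) =
      I ^ (k + 1) * (-1) ^ (k + (b + 1)) / ((k + (b + 1))! : ℂ) *
        ∑ r ∈ Finset.range (b + 1 + 1), ∑ m ∈ Finset.range (r + 1),
          (multinom3 (k + (b + 1)) k m (r - m) : ℂ) * (I / 2) ^ r * (-(π : ℂ)) ^ (r - m) *
            (logSine (k + (b + 1) + 1 - (r - m)) (k + m) τ : ℂ) := by
  have hintegral := logWeightedPolylog_exp_sub_eq_integral k b hτ₀ hτ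
  have hfactor (t : ℝ) : I * ((-I * t) ^ k / (k ! : ℂ)) / ((b + 1)! : ℂ) *
      (-Complex.log (1 - Complex.exp (I * t))) ^ (b + 1) =
        I ^ (k + 1) * (-1) ^ (k + (b + 1)) / (k ! * (b + 1)! : ℂ) *
          ((t : ℂ) ^ k * Complex.log (1 - Complex.exp (I * t)) ^ (b + 1)) := by
    rw [neg_pow (Complex.log _), mul_pow, neg_pow I]
    ring
  simp only [hfactor, intervalIntegral.integral_const_mul] at hintegral
  rw [multiZeta_nielsenIndex_duality, add_comm 2 b] at hintegral
  have hexpansion := integral_pow_mul_log_one_sub_exp_pow k (b + 1) hτ₀ hτ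
  have hfac (n : ℕ) : (n ! : ℂ) ≠ 0 := Nat.cast_ne_zero.2 n.factorial_ne_zero
  rw [← neg_sub, hintegral, ← neg_eq_iff_eq_neg.2 hexpansion]
  field_simp [hfac]

theorem multiZeta_sub_sum_multiPolylog_eq_sum_logSine {n k : ℕ} (hn : k + 2 ≤ n) (hτ₀ : 0 ≤ τ)
    (hτ : τ ≤ 2 * π) :
    multiZeta (nielsenIndex (n - k) k) -
        ∑ j ∈ Finset.range (k + 1), (-I * (τ : ℂ)) ^ j / (j ! : ℂ) *
          multiPolylog (nielsenIndex (2 + k - j) (n - k - 2)) (Complex.exp (I * (τ : ℂ))) =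
      I ^ (k + 1) * (-1) ^ (n - 1) / ((n - 1)! : ℂ) *
        ∑ r ∈ Finset.range (n - k), ∑ m ∈ Finset.range (r + 1),
          (multinom3 (n - 1) k m (r - m) : ℂ) * (I / 2) ^ r * (-(π : ℂ)) ^ (r - m) *
            (logSine (n - (r - m)) (k + m) τ : ℂ) := by
  obtain ⟨b, rfl⟩ : ∃ b, n = k + (b + 1) + 1 := ⟨n - k - 2, by omega⟩
  rw [show k + (b + 1) + 1 - k - 2 = b by omega, show k + (b + 1) + 1 - k = b + 2 by omega,
    Nat.add_sub_cancel]
  exact multiZeta_sub_logWeightedPolylog_eq_sum_logSine k b hτ₀ hτ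

end Expansion

section RealAndImaginaryParts

variable {X : Type*}

lemma div_natCast_mem {K : Type*} [DivisionRing K] [Algebra ℚ K] {B : Subalgebra ℚ (X → K)}
    {f : X → K} (hf : f ∈ B) (n : ℕ) : (fun x => f x / n) ∈ B := by
  convert B.mul_mem hf (B.algebraMap_mem (n : ℚ)⁻¹) using 1
  funext x
  simp [div_eq_mul_inv]

/-- The complex-valued functions whose real and imaginary parts lie in `A`. Relations between
polylogarithms are solved in this algebra before passing to real parts. -/
def reImSubalgebra (A : Subalgebra ℚ (X → ℝ)) : Subalgebra ℚ (X → ℂ) where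
  carrier := {f | (fun x => (f x).re) ∈ A ∧ (fun x => (f x).im) ∈ A}
  mul_mem' hf hg :=
    ⟨A.sub_mem (A.mul_mem hf.1 hg.1) (A.mul_mem hf.2 hg.2),
      A.add_mem (A.mul_mem hf.1 hg.2) (A.mul_mem hf.2 hg.1)⟩
  add_mem' hf hg := ⟨A.add_mem hf.1 hg.1, A.add_mem hf.2 hg.2⟩
  algebraMap_mem' q := ⟨A.algebraMap_mem q, by convert A.zero_mem using 1; funext x; simp⟩

variable {A : Subalgebra ℚ (X → ℝ)}

lemma ofReal_mem_reImSubalgebra {f : X → ℝ} (hf : f ∈ A) :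
    (fun x => (f x : ℂ)) ∈ reImSubalgebra A :=
  ⟨hf, A.zero_mem⟩

lemma I_mem_reImSubalgebra : (fun _ => I) ∈ reImSubalgebra A :=
  ⟨A.zero_mem, A.one_mem⟩

lemma mem_reImSubalgebra_of_I_pow_mul_ratCast_mul_mem {f : X → ℂ} (j : ℕ) {q : ℚ} (hq : q ≠ 0)
    (hf : (fun x => I ^ j * q * f x) ∈ reImSubalgebra A) : f ∈ reImSubalgebra A := by
  set B := reImSubalgebra A
  convert B.mul_mem (B.mul_mem (B.pow_mem (B.neg_mem I_mem_reImSubalgebra) j)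
    (B.algebraMap_mem q⁻¹)) hf using 1
  funext x
  have hI : (-I) ^ j * I ^ j = 1 := by simp [← mul_pow]
  have hq' : (q : ℂ) ≠ 0 := Rat.cast_ne_zero.2 hq
  calc f x = ((-I) ^ j * I ^ j) * ((q : ℂ)⁻¹ * q) * f x := by simp [hI, hq']
    _ = (-I) ^ j * ((q⁻¹ : ℚ) : ℂ) * (I ^ j * q * f x) := by push_cast; ring

end RealAndImaginaryParts

section LogSineAlgebra

/-- The functions on `[0, 2π]` that are polynomials with rational coefficients in `π`, `τ`, the
zeta values and the multiple Clausen and Glaisher functions of Nielsen type. -/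
abbrev logSineAlgebra : Subalgebra ℚ (Icc (0 : ℝ) (2 * π) → ℝ) :=
  Algebra.adjoin ℚ {f | IsLogSineGenerator f}

lemma multiZeta_nielsenIndex_mem {s : ℕ} (hs : 2 ≤ s) (b : ℕ) :
    (fun _ => multiZeta (nielsenIndex s b)) ∈ reImSubalgebra logSineAlgebra := by
  have hre : _ ∈ logSineAlgebra := Algebra.subset_adjoin (IsLogSineGenerator.zeta s b hs)
  simpa only [ofReal_re_multiZeta] using ofReal_mem_reImSubalgebra hre

lemma multiPolylog_exp_mem {s : ℕ} (hs : 2 ≤ s) (b : ℕ) :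
    (fun τ : Icc (0 : ℝ) (2 * π) => multiPolylog (nielsenIndex s b) (Complex.exp (I * (τ : ℝ)))) ∈
      reImSubalgebra logSineAlgebra := by
  have hclausen := Algebra.subset_adjoin (R := ℚ) (IsLogSineGenerator.clausen s b hs)
  have hglaisher := Algebra.subset_adjoin (R := ℚ) (IsLogSineGenerator.glaisher s b hs)
  by_cases hw : Even (∑ i, nielsenIndex s b i)
  · simp only [multiClausen, multiGlaisher, if_pos hw] at hclausen hglaisher
    exact ⟨hglaisher, hclausen⟩
  · simp only [multiClausen, multiGlaisher, if_neg hw] at hclausen hglaisher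
    exact ⟨hclausen, hglaisher⟩

lemma ofReal_arg_mem : (fun τ : Icc (0 : ℝ) (2 * π) => ((τ : ℝ) : ℂ)) ∈
      reImSubalgebra logSineAlgebra :=
  ofReal_mem_reImSubalgebra (Algebra.subset_adjoin IsLogSineGenerator.arg)

lemma ofReal_pi_mem : (fun _ => (π : ℂ)) ∈ reImSubalgebra logSineAlgebra :=
  ofReal_mem_reImSubalgebra (Algebra.subset_adjoin IsLogSineGenerator.pi)

lemma logWeightedPolylog_exp_mem (k b : ℕ) :
    (fun τ : Icc (0 : ℝ) (2 * π) =>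
      logWeightedPolylog k (1 : Fin b → ℕ) (-I * (τ : ℝ)) (Complex.exp (I * (τ : ℝ)))) ∈
      reImSubalgebra logSineAlgebra := by
  simp only [logWeightedPolylog, ← Finset.sum_fn]
  refine Subalgebra.sum_mem _ fun j hj => Subalgebra.mul_mem _ (div_natCast_mem
    (Subalgebra.pow_mem _ (Subalgebra.mul_mem _ (Subalgebra.neg_mem _ I_mem_reImSubalgebra)
      ofReal_arg_mem) j) _) ?_
  exact multiPolylog_exp_mem (by have := Finset.mem_range.1 hj; omega) b

lemma logSine_succ_self (k : ℕ) (τ : ℝ) :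
    logSine (k + 1) k τ = -(τ ^ (k + 1) / (k + 1 : ℕ)) := by
  simp [logSine, logSineIntegrand, integral_pow]

lemma ofReal_logSine_succ_self_mem (k : ℕ) :
    (fun τ : Icc (0 : ℝ) (2 * π) => (logSine (k + 1) k τ : ℂ)) ∈ reImSubalgebra logSineAlgebra := by
  convert Subalgebra.neg_mem _
    (div_natCast_mem (Subalgebra.pow_mem _ ofReal_arg_mem (k + 1)) (k + 1)) using 1
  funext τ
  simp [logSine_succ_self]

lemma sum_multinom3_mul_logSine_mem (k b : ℕ)
    (h : ∀ N ≤ b, ∀ l,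
      (fun τ : Icc (0 : ℝ) (2 * π) => (logSine (l + N + 1) l τ : ℂ)) ∈
        reImSubalgebra logSineAlgebra) :
    (fun τ : Icc (0 : ℝ) (2 * π) =>
      ∑ r ∈ Finset.range (b + 1), ∑ m ∈ Finset.range (r + 1 + 1),
        (multinom3 (k + (b + 1)) k m (r + 1 - m) : ℂ) * (I / 2) ^ (r + 1) *
          (-(π : ℂ)) ^ (r + 1 - m) *
          (logSine (k + (b + 1) + 1 - (r + 1 - m)) (k + m) τ : ℂ)) ∈
      reImSubalgebra logSineAlgebra := by
  have hI : (fun _ => I / 2) ∈ reImSubalgebra logSineAlgebra := by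
    simpa using div_natCast_mem (I_mem_reImSubalgebra (A := logSineAlgebra)) 2
  simp only [← Finset.sum_fn]
  refine Subalgebra.sum_mem _ fun r hr => Subalgebra.sum_mem _ fun m hm => ?_
  have hlogSine := h (b - r) (Nat.sub_le _ _) (k + m)
  rw [show k + m + (b - r) + 1 = k + (b + 1) + 1 - (r + 1 - m) by grind] at hlogSine
  exact Subalgebra.mul_mem _ (Subalgebra.mul_mem _ (Subalgebra.mul_mem _
    (Subalgebra.algebraMap_mem _ _) (Subalgebra.pow_mem _ hI _))
    (Subalgebra.pow_mem _ (Subalgebra.neg_mem _ ofReal_pi_mem) _)) hlogSine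

lemma I_pow_mul_logSine_eq (k b : ℕ) {τ : ℝ} (hτ₀ : 0 ≤ τ) (hτ : τ ≤ 2 * π) :
    I ^ (k + 1) * (((-1) ^ (k + (b + 1)) / (k ! * (b + 1)!) : ℚ) : ℂ) *
        (logSine (k + (b + 1) + 1) k τ : ℂ) =
      multiZeta (nielsenIndex (b + 2) k) -
        logWeightedPolylog k (1 : Fin b → ℕ) (-I * τ) (Complex.exp (I * τ)) -
      I ^ (k + 1) * (((-1) ^ (k + (b + 1)) / (k + (b + 1))! : ℚ) : ℂ) *
        ∑ r ∈ Finset.range (b + 1), ∑ m ∈ Finset.range (r + 1 + 1),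
          (multinom3 (k + (b + 1)) k m (r + 1 - m) : ℂ) * (I / 2) ^ (r + 1) *
            (-(π : ℂ)) ^ (r + 1 - m) *
            (logSine (k + (b + 1) + 1 - (r + 1 - m)) (k + m) τ : ℂ) := by
  have hfac (n : ℕ) : (n ! : ℂ) ≠ 0 := Nat.cast_ne_zero.2 n.factorial_ne_zero
  rw [multiZeta_sub_logWeightedPolylog_eq_sum_logSine k b hτ₀ hτ,
    Finset.sum_range_succ' _ (b + 1), zero_add, Finset.sum_range_one,
    multinom3_eq (Nat.zero_le _) le_rfl]
  simp only [Nat.choose_zero_right, Nat.sub_zero, pow_zero, add_zero]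
  push_cast
  field_simp [hfac]
  ring

theorem ofReal_logSine_mem (N k : ℕ) :
    (fun τ : Icc (0 : ℝ) (2 * π) => (logSine (k + N + 1) k τ : ℂ)) ∈
      reImSubalgebra logSineAlgebra := by
  induction N using Nat.strong_induction_on generalizing k with
  | _ N ih =>
  rcases N with _ | b
  · exact ofReal_logSine_succ_self_mem k
  have hq : ((-1) ^ (k + (b + 1)) / (k ! * (b + 1)!) : ℚ) ≠ 0 := by positivity
  refine mem_reImSubalgebra_of_I_pow_mul_ratCast_mul_mem (k + 1) hq ?_
  simp only [fun τ : Icc (0 : ℝ) (2 * π) => I_pow_mul_logSine_eq k b τ.2.1 τ.2.2]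
  have hsum := sum_multinom3_mul_logSine_mem k b fun N hN => ih N (Nat.lt_succ_of_le hN)
  exact Subalgebra.sub_mem _ (Subalgebra.sub_mem _ (multiZeta_nielsenIndex_mem (by omega) k)
    (logWeightedPolylog_exp_mem k b)) (Subalgebra.mul_mem _ (Subalgebra.mul_mem _
      (Subalgebra.pow_mem _ I_mem_reImSubalgebra _) (Subalgebra.algebraMap_mem _ _)) hsum)

end LogSineAlgebra

end

theorem theorem4 :
    -- the series and integrals involved converge (absolutely)
    (∀ (s b : ℕ) (z : ℂ), 2 ≤ s → ‖z‖ ≤ 1 →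
      Summable (multiPolylogTerm (nielsenIndex s b) z)) ∧
    (∀ (n k : ℕ) (τ : ℝ), k + 1 ≤ n → 0 ≤ τ → τ ≤ 2 * Real.pi →
      IntervalIntegrable (logSineIntegrand n k) MeasureTheory.volume 0 τ) ∧
    -- the identity
    (∀ (n k : ℕ) (τ : ℝ), k + 2 ≤ n → 0 ≤ τ → τ ≤ 2 * Real.pi →
      multiZeta (nielsenIndex (n - k) k)
          - ∑ j ∈ Finset.range (k + 1), (-Complex.I * (τ : ℂ)) ^ j / (j.factorial : ℂ)
              * multiPolylog (nielsenIndex (2 + k - j) (n - k - 2))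
                  (Complex.exp (Complex.I * (τ : ℂ)))
        = Complex.I ^ (k + 1) * (-1) ^ (n - 1) / ((n - 1).factorial : ℂ)
          * ∑ r ∈ Finset.range (n - k), ∑ m ∈ Finset.range (r + 1),
              (multinom3 (n - 1) k m (r - m) : ℂ) * (Complex.I / 2) ^ r
                * (-(Real.pi : ℂ)) ^ (r - m)
                * (logSine (n - (r - m)) (k + m) τ : ℂ)) ∧
    -- every log-sine integral, as a function of `τ ∈ [0, 2π]`, is a polynomial with rational
    -- coefficients in the generators
    (∀ n k : ℕ, k + 1 ≤ n →
      (fun τ : Set.Icc (0 : ℝ) (2 * Real.pi) => logSine n k τ) ∈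
        Algebra.adjoin ℚ {f | IsLogSineGenerator f}) := by
  refine ⟨fun s b z hs hz => summable_multiPolylogTerm hs (one_le_nielsenIndex (by omega) b) hz,
    fun n k τ _ hτ₀ hτ => intervalIntegrable_logSineIntegrand n k hτ₀ hτ,
    fun n k τ hn hτ₀ hτ => multiZeta_sub_sum_multiPolylog_eq_sum_logSine hn hτ₀ hτ,
    fun n k hn => ?_⟩
  obtain ⟨N, rfl⟩ : ∃ N, n = k + N + 1 := ⟨n - k - 1, by omega⟩
  exact (ofReal_logSine_mem N k).1
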